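/- For every finite nonempty lattice $L$ there is a matroid $M$ on a finite ground set $E$ such that the lattice of cyclic flats of $M$, ordered by inclusion, is isomorphic to $L$, and $M$ is bitransversal, that is, both $M$ and its dual $M^*$ are transversal matroids. (A cyclic flat is a flat that is a possibly empty union of circuits.) Moreover, $M$ can be taken to be a fundamental transversal matroid obtained by placing points freely in faces of a simplex. That is, $M$ has a basis $B$ such that each cyclic flat of $M$ is the closure of a subset of $B$, and $M$ arises as follows. The elements of $B$ are put at affinely independent points of $\mathbb{R}^{B}$. Each $x\in E\setminus B$ is assigned a set $V_x\subseteq B$ and, if $V_x\neq\emptyset$, a point in the convex hull of the points of $V_x$. A subset of $E$ is independent in $M$ if and only if it contains no $x\in E\setminus B$ with $V_x=\emptyset$ and its elements are at distinct, affinely independent points. The placement is free: whenever $x\in E\setminus B$ lies in the closure of a set $S\subseteq E\setminus\{x\}$, also $V_x$ lies in the closure of $S$. -/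

import Mathlib

universe u

namespace CyclicFlatLattice

/-- A set is cyclic if it is a (possibly empty) union of circuits. -/
def IsCyclic {α : Type u} (M : Matroid α) (F : Set α) : Prop :=
  ∃ 𝒞 : Set (Set α), (∀ C ∈ 𝒞, M.IsCircuit C) ∧ F = ⋃₀ 𝒞

/-- A cyclic flat is a flat that is a union of circuits. -/
def IsCyclicFlat {α : Type u} (M : Matroid α) (F : Set α) : Prop :=
  M.IsFlat F ∧ IsCyclic M F

/-- The type of cyclic flats of a matroid. -/
def CyclicFlat {α : Type u} (M : Matroid α) : Type u :=
  {F : Set α // IsCyclicFlat M F}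

theorem isCyclic_iff {α : Type u} {M : Matroid α} {F : Set α} :
    IsCyclic M F ↔ ∀ x ∈ F, ∃ C, M.IsCircuit C ∧ C ⊆ F ∧ x ∈ C := by
  constructor
  · rintro ⟨𝒞, h, rfl⟩ x ⟨C, hC, hx⟩
    exact ⟨C, h C hC, Set.subset_sUnion_of_mem hC, hx⟩
  · intro h
    refine ⟨{C | M.IsCircuit C ∧ C ⊆ F}, fun C hC => hC.1, ?_⟩
    ext x
    constructor
    · intro hx
      obtain ⟨C, hC, hCF, hxC⟩ := h x hx
      exact ⟨C, ⟨hC, hCF⟩, hxC⟩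
    · rintro ⟨C, hC, hx⟩
      exact hC.2 hx

theorem isCyclicFlat_join {α : Type u} {M : Matroid α} {F G : Set α}
    (hF : IsCyclicFlat M F) (hG : IsCyclicFlat M G) :
    IsCyclicFlat M (M.closure (F ∪ G)) := by
  have hE : F ∪ G ⊆ M.E := Set.union_subset hF.1.subset_ground hG.1.subset_ground
  refine ⟨M.isFlat_closure _, isCyclic_iff.2 fun x hx => ?_⟩
  by_cases hxU : x ∈ F ∪ G
  · rcases hxU with hxF | hxG
    · obtain ⟨C, hC, hCF, hxC⟩ := isCyclic_iff.1 hF.2 x hxF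
      exact ⟨C, hC, (hCF.trans Set.subset_union_left).trans (M.subset_closure _ hE), hxC⟩
    · obtain ⟨C, hC, hCG, hxC⟩ := isCyclic_iff.1 hG.2 x hxG
      exact ⟨C, hC, (hCG.trans Set.subset_union_right).trans (M.subset_closure _ hE), hxC⟩
  · obtain ⟨C, hCs, hC, hxC⟩ := Matroid.exists_isCircuit_of_mem_closure hx hxU
    exact ⟨C, hC, hCs.trans (Set.insert_subset hx (M.subset_closure _ hE)), hxC⟩

theorem isCyclicFlat_meet {α : Type u} {M : Matroid α} {F G : Set α}
    (hF : IsCyclicFlat M F) (hG : IsCyclicFlat M G) :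
    IsCyclicFlat M (⋃₀ {C | M.IsCircuit C ∧ C ⊆ F ∩ G}) := by
  set U : Set α := ⋃₀ {C | M.IsCircuit C ∧ C ⊆ F ∩ G} with hU
  have hUs : U ⊆ F ∩ G := Set.sUnion_subset fun C hC => hC.2
  have hUE : U ⊆ M.E := hUs.trans (Set.inter_subset_left.trans hF.1.subset_ground)
  refine ⟨?_, _, fun C hC => hC.1, rfl⟩
  rw [Matroid.isFlat_iff_closure_eq]
  refine Set.Subset.antisymm (fun x hx => ?_) (M.subset_closure _ hUE)
  by_contra hxU
  obtain ⟨C, hCs, hC, hxC⟩ := Matroid.exists_isCircuit_of_mem_closure hx hxU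
  have hxF : x ∈ F := by
    have := M.closure_subset_closure (hUs.trans Set.inter_subset_left) hx
    rwa [hF.1.closure] at this
  have hxG : x ∈ G := by
    have := M.closure_subset_closure (hUs.trans Set.inter_subset_right) hx
    rwa [hG.1.closure] at this
  exact hxU ⟨C, ⟨hC, hCs.trans (Set.insert_subset ⟨hxF, hxG⟩ hUs)⟩, hxC⟩

/-- Cyclic flats are ordered by inclusion. -/
instance {α : Type u} (M : Matroid α) : PartialOrder (CyclicFlat M) :=
  inferInstanceAs (PartialOrder {F : Set α // IsCyclicFlat M F})

/-- The lattice of cyclic flats: the join of `F` and `G` is the closure of `F ∪ G`, and their meet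
is the union of all circuits contained in `F ∩ G`. -/
instance {α : Type u} (M : Matroid α) : Lattice (CyclicFlat M) where
  sup F G := ⟨M.closure (F.1 ∪ G.1), isCyclicFlat_join F.2 G.2⟩
  inf F G := ⟨⋃₀ {C | M.IsCircuit C ∧ C ⊆ F.1 ∩ G.1}, isCyclicFlat_meet F.2 G.2⟩
  le_sup_left F G := Set.subset_union_left.trans
    (M.subset_closure _ (Set.union_subset F.2.1.subset_ground G.2.1.subset_ground))
  le_sup_right F G := Set.subset_union_right.trans
    (M.subset_closure _ (Set.union_subset F.2.1.subset_ground G.2.1.subset_ground))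
  sup_le F G H hF hG := by
    have h := M.closure_subset_closure (Set.union_subset hF hG)
    rwa [H.2.1.closure] at h
  inf_le_left F G := Set.sUnion_subset fun C hC => hC.2.trans Set.inter_subset_left
  inf_le_right F G := Set.sUnion_subset fun C hC => hC.2.trans Set.inter_subset_right
  le_inf F G H hG hH := by
    intro x hx
    obtain ⟨C, hC, hCF, hxC⟩ := isCyclic_iff.1 F.2.2 x hx
    exact ⟨C, ⟨hC, Set.subset_inter (hCF.trans hG) (hCF.trans hH)⟩, hxC⟩

/-- `M` is transversal if its independent sets are the partial transversals of a finite family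
of subsets of its ground set. -/
def IsTransversal {α : Type u} (M : Matroid α) : Prop :=
  ∃ (n : ℕ) (A : Fin n → Set α), (∀ j, A j ⊆ M.E) ∧
    ∀ I : Set α, M.Indep I ↔ ∃ f : I → Fin n, Function.Injective f ∧ ∀ x : I, (x : α) ∈ A (f x)

/-- `M` is bitransversal if both `M` and its dual are transversal. -/
def IsBitransversal {α : Type u} (M : Matroid α) : Prop :=
  IsTransversal M ∧ IsTransversal M✶

/-- `B` is a basis of `M` such that every cyclic flat of `M` is spanned by a subset of `B`; a matroid
with such a basis is a fundamental (or principal) transversal matroid. -/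
def IsFundamentalBasis {α : Type u} (M : Matroid α) (B : Set α) : Prop :=
  M.IsBase B ∧ ∀ F, IsCyclicFlat M F → ∃ X ⊆ B, M.closure X = F

/-- `M` is obtained by putting the elements of `B` at the vertices of a simplex in `ℝ^B` and
placing each remaining element `x` of `M` freely in the face with vertex set `V x`. Here `p x` is the
position of `x`. The elements placed in the empty face are the loops of `M`; they have no position,
and the value of `p` at them is irrelevant. -/
structure IsFreeSimplexPlacement {α : Type u} (M : Matroid α) (B : Set α) (V : α → Set α)
    (p : α → (B → ℝ)) : Prop where
  subset_ground : B ⊆ M.E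
  /-- The elements of `B` are at the vertices of a simplex. -/
  vertices : AffineIndependent ℝ (fun b : B => p b)
  /-- Each `x` outside `B` is assigned a face. -/
  face_subset : ∀ x ∈ M.E \ B, V x ⊆ B
  /-- Each `x` outside `B` lies in its face. -/
  mem_face : ∀ x ∈ M.E \ B, (V x).Nonempty → p x ∈ convexHull ℝ (p '' V x)
  /-- `M` is the matroid of affine dependence of the points, with the elements that are placed in
  the empty face as loops. -/
  indep_iff : ∀ I : Set α, M.Indep I ↔
    I ⊆ M.E ∧ (∀ x ∈ I \ B, (V x).Nonempty) ∧ AffineIndependent ℝ (fun i : I => p i)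
  /-- Freeness: `x` is spanned by other elements only if they span the whole face of `x`. -/
  free : ∀ x ∈ M.E \ B, ∀ S ⊆ M.E \ {x}, x ∈ M.closure S → V x ⊆ M.closure S

end CyclicFlatLattice

/-! Take the simplex with vertex set a copy of `L` and, for each `a`, one extra point placed freely
in the face `{m | ¬ a ≤ m}`. Inclusion of these faces is the order of `L`, and since `a ⊔ b ≤ m` iff
`a ≤ m` and `b ≤ m`, joins turn into unions.

In a free placement a set `Y` of vertices spans exactly the points whose face lies in `Y`
(`closure_eq`). A cyclic flat is spanned by its vertices (`closure_inter_eq`), and each of these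
lies in the face of some non-vertex of the flat (`exists_mem_face`). The vertices of a cyclic flat
are thus a union of faces, that is, the face of a join; conversely every face spans a cyclic flat
(`isCyclicFlat_closure`).

Free placements exist because generic barycentric coordinates make linear independence coincide with
matchability in the bipartite graph of faces. Reversing this graph presents the dual
(`dual_indep_iff`), so both matroids are transversal. -/

namespace CyclicFlatLattice

/-! ### Generic weights on a bipartite graph. -/

section Generic

variable {α ι : Type*} [Finite α] [Fintype ι] [DecidableEq ι]

/-- A polynomial vanishing on a product of infinite sets is zero. Positivity later turns the weights
into convex coefficients. -/
theorem exists_pos_eval_ne_zero {σ : Type*} {Q : MvPolynomial σ ℝ} (hQ : Q ≠ 0) :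
    ∃ x : σ → ℝ, (∀ i, 0 < x i) ∧ MvPolynomial.eval x Q ≠ 0 := by
  by_contra! h
  refine hQ (MvPolynomial.funext_set (fun _ => Set.Ioi 0) (fun _ => Set.Ioi_infinite 0) ?_)
  intro x hx
  rw [h x fun i => hx i trivial, map_zero]

/-- Generic weights on a bipartite graph: every square submatrix that has a perfect matching is
nonsingular. -/
theorem exists_generic_weight (V : α → Set ι) :
    ∃ w : α → ι → ℝ, (∀ a, ∀ i ∈ V a, 0 < w a i) ∧ (∀ a, ∀ i ∉ V a, w a i = 0) ∧
      ∀ g : ι → α, Function.Injective g → (∀ i, i ∈ V (g i)) →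
        (Matrix.of fun i j => w (g i) j).det ≠ 0 := by
  classical
  have := Fintype.ofFinite α
  let P (g : ι → α) : Matrix ι ι (MvPolynomial (α × ι) ℝ) :=
    Matrix.of fun i j => if j ∈ V (g i) then MvPolynomial.X (g i, j) else 0
  have hP (x : α × ι → ℝ) (g : ι → α) : MvPolynomial.eval x (P g).det =
      (Matrix.of fun i j => if j ∈ V (g i) then x (g i, j) else 0).det := by
    rw [RingHom.map_det]
    congr 1
    ext i j
    simp only [P, RingHom.mapMatrix_apply, Matrix.map_apply, Matrix.of_apply]
    split_ifs <;> simp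
  have hne (g : ι → α) (hg : Function.Injective g) (hgV : ∀ i, i ∈ V (g i)) : (P g).det ≠ 0 := by
    intro h0
    -- At the indicator of the matching `g` the matrix becomes the identity.
    have h1 := hP (fun y => if g y.2 = y.1 then 1 else 0) g
    have h2 : (Matrix.of fun i j => if j ∈ V (g i) then
        (if g j = g i then (1 : ℝ) else 0) else 0) = 1 := by
      ext i j
      rw [Matrix.of_apply, Matrix.one_apply]
      by_cases hij : i = j
      · subst hij
        simp [hgV]
      · have : g j ≠ g i := fun h => hij (hg h).symm
        simp [hij, this]
    simp only [] at h1
    rw [h2, h0, map_zero, Matrix.det_one] at h1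
    exact zero_ne_one h1
  let S : Finset (ι → α) :=
    Finset.univ.filter fun g => Function.Injective g ∧ ∀ i, i ∈ V (g i)
  -- The product lets a single point serve all matchings at once.
  have hQ : ∏ g ∈ S, (P g).det ≠ 0 :=
    Finset.prod_ne_zero_iff.2 fun g hg => hne g (Finset.mem_filter.1 hg).2.1
      (Finset.mem_filter.1 hg).2.2
  obtain ⟨x, hx, hxQ⟩ := exists_pos_eval_ne_zero hQ
  rw [map_prod, Finset.prod_ne_zero_iff] at hxQ
  refine ⟨fun a i => if i ∈ V a then x (a, i) else 0, ?_, ?_, ?_⟩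
  · intro a i hi
    simp [hi, hx]
  · intro a i hi
    simp [hi]
  · intro g hg hgV
    have := hxQ g (Finset.mem_filter.2 ⟨Finset.mem_univ _, hg, hgV⟩)
    rwa [hP] at this

/-- Generic weights can be normalized so that every nonempty neighbourhood has total weight one. -/
theorem exists_normalized_generic_weight (V : α → Set ι) :
    ∃ w : α → ι → ℝ, (∀ a i, 0 ≤ w a i) ∧ (∀ a, ∀ i ∉ V a, w a i = 0) ∧
      (∀ a, (V a).Nonempty → ∑ i, w a i = 1) ∧
      ∀ g : ι → α, Function.Injective g → (∀ i, i ∈ V (g i)) →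
        (Matrix.of fun i j => w (g i) j).det ≠ 0 := by
  obtain ⟨w, hpos, hzero, hdet⟩ := exists_generic_weight V
  have hnn (a i) : 0 ≤ w a i := by
    by_cases hi : i ∈ V a
    · exact (hpos a i hi).le
    · exact (hzero a i hi).ge
  have hsum (a) (ha : (V a).Nonempty) : 0 < ∑ i, w a i := by
    obtain ⟨i, hi⟩ := ha
    exact Finset.sum_pos' (fun i _ => hnn a i) ⟨i, Finset.mem_univ _, hpos a i hi⟩
  refine ⟨fun a i => (∑ j, w a j)⁻¹ * w a i, ?_, ?_, ?_, ?_⟩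
  · exact fun a i => mul_nonneg (inv_nonneg.2 (Finset.sum_nonneg fun j _ => hnn a j)) (hnn a i)
  · intro a i hi
    simp [hzero a i hi]
  · intro a ha
    rw [← Finset.mul_sum, inv_mul_cancel₀ (hsum a ha).ne']
  · intro g hg hgV
    -- Normalizing scales each row by a nonzero factor.
    have := Matrix.det_mul_column (fun i => (∑ j, w (g i) j)⁻¹) (Matrix.of fun i j => w (g i) j)
    simp only [Matrix.of_apply] at this
    rw [this]
    exact mul_ne_zero (Finset.prod_ne_zero_iff.2 fun i _ =>
      inv_ne_zero (hsum (g i) ⟨i, hgV i⟩).ne') (hdet g hg hgV)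

end Generic

/-- The matroid of linear independence of a finite family of vectors. -/
noncomputable def linearMatroid {α W : Type*} [Finite α] [AddCommGroup W] [Module ℝ W]
    (v : α → W) : Matroid α :=
  (IndepMatroid.ofFinite (E := Set.univ) Set.finite_univ (fun I => LinearIndepOn ℝ v I)
    (linearIndepOn_empty ℝ v) (fun _ _ hJ hIJ => hJ.mono hIJ)
    (by
      intro I J hI hJ hIJ
      by_contra! h
      have hsub : v '' J ⊆ Submodule.span ℝ (v '' I) := by
        rintro _ ⟨e, heJ, rfl⟩
        by_contra he
        by_cases heI : e ∈ I
        · exact he (Submodule.subset_span ⟨e, heI, rfl⟩)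
        · exact h e heJ heI (hI.insert he)
      have := FiniteDimensional.span_of_finite ℝ (Set.toFinite (v '' I))
      have hle := Submodule.finrank_mono (R := ℝ) (Submodule.span_le.2 hsub)
      have := Fintype.ofFinite I
      have := Fintype.ofFinite J
      rw [Set.image_eq_range, Set.image_eq_range, finrank_span_eq_card hI,
        finrank_span_eq_card hJ, ← Nat.card_eq_fintype_card, ← Nat.card_eq_fintype_card] at hle
      exact absurd hIJ (not_lt.2 hle))
    (fun _ _ => Set.subset_univ _)).matroid

/-- `I` can be matched into the neighbourhoods `V a`, `a ∈ I`. -/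
def IsMatchable {α : Type*} (V : α → Set α) (I : Set α) : Prop :=
  ∃ f : α → α, Set.InjOn f I ∧ ∀ a ∈ I, f a ∈ V a

/-! ### Linear independence of generic vectors as matchability. -/

section Representation

variable {α : Type*} {B : Set α} {V : α → Set α} {w : α → B → ℝ}

/-- Matching each unused vertex to itself completes the matching to a perfect one, whose square
matrix is nonsingular and has the vectors of `I` among its rows. -/
theorem IsMatchable.linearIndepOn [Fintype B] [DecidableEq B] (hVB : ∀ a, V a ⊆ B)
    (hB : ∀ b ∈ B, V b = {b})
    (hdet : ∀ g : B → α, Function.Injective g → (∀ i, (i : α) ∈ V (g i)) →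
      (Matrix.of fun i j => w (g i) j).det ≠ 0)
    {I : Set α} (hI : IsMatchable V I) : LinearIndepOn ℝ w I := by
  classical
  obtain ⟨f, hf, hfV⟩ := hI
  have key (b : B) : ∃ a, (b : α) ∈ V a ∧ (∀ a' ∈ I, f a' = b → a = a') ∧ (a ∉ I → a = b) ∧
      (a ∈ I → f a = b) := by
    by_cases h : ∃ a ∈ I, f a = b
    · obtain ⟨a, haI, hab⟩ := h
      exact ⟨a, hab ▸ hfV a haI, fun a' ha' h' => hf haI ha' (hab.trans h'.symm),
        fun h => (h haI).elim, fun _ => hab⟩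
    · push Not at h
      refine ⟨b, by rw [hB b b.2]; rfl, fun a' ha' h' => (h a' ha' h').elim, fun _ => rfl, ?_⟩
      intro hb
      have := hfV b hb
      rwa [hB b b.2] at this
  choose g hgV hgI hgn hgf using key
  have hginj : Function.Injective g := by
    intro b c hbc
    by_cases hb : g b ∈ I
    · exact Subtype.ext ((hgf b hb).symm.trans ((congrArg f hbc).trans (hgf c (hbc ▸ hb))))
    · exact Subtype.ext ((hgn b hb).symm.trans (hbc.trans (hgn c (hbc ▸ hb))))
  have hli : LinearIndependent ℝ (w ∘ g) :=
    Matrix.linearIndependent_rows_of_det_ne_zero (hdet g hginj hgV)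
  refine ((linearIndepOn_range_iff hginj w).2 hli).mono fun a ha => ?_
  exact ⟨⟨f a, hVB a (hfV a ha)⟩, hgI _ a ha rfl⟩

/-- Extend `I` to a basis. Its determinant has a nonzero Leibniz term, and the permutation of that
term is a matching because weights vanish off `V`. -/
theorem isMatchable_of_linearIndepOn [Fintype B] [DecidableEq B]
    (hw : ∀ a, ∀ i : B, (i : α) ∉ V a → w a i = 0) (hwB : ∀ b : B, w b = Pi.single b 1)
    {I : Set α} (hI : LinearIndepOn ℝ w I) : IsMatchable V I := by
  classical
  let J := hI.extend (Set.subset_univ I)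
  have hIJ : I ⊆ J := hI.subset_extend _
  have hJ : LinearIndepOn ℝ w J := hI.linearIndepOn_extend _
  have hspan : ⊤ ≤ Submodule.span ℝ (Set.range fun j : J => w j) := by
    rw [← Set.image_eq_range, hI.span_image_extend_eq_span_image,
      ← (Pi.basisFun ℝ B).span_eq]
    refine Submodule.span_mono ?_
    rintro _ ⟨b, rfl⟩
    exact ⟨b, trivial, by rw [hwB, Pi.basisFun_apply]⟩
  let bas := Module.Basis.mk hJ hspan
  let e : B ≃ J := (Pi.basisFun ℝ B).indexEquiv bas
  have hli : LinearIndependent ℝ (Matrix.of fun i j : B => w (e i) j).row :=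
    LinearIndependent.comp hJ e e.injective
  have hdet := (Matrix.isUnit_iff_isUnit_det _).1 (Matrix.linearIndependent_rows_iff_isUnit.1 hli)
  have hne := hdet.ne_zero
  rw [Matrix.det_apply] at hne
  obtain ⟨σ, -, hσ⟩ := Finset.exists_ne_zero_of_sum_ne_zero hne
  have hσ' : ∀ i, w (e (σ i)) i ≠ 0 := by
    intro i hi
    apply hσ
    have h0 : ∏ i, (Matrix.of fun i j : B => w (e i) j) (σ i) i = 0 :=
      Finset.prod_eq_zero (Finset.mem_univ i) hi
    rw [h0, smul_zero]
  refine ⟨fun a => if h : a ∈ J then (σ.symm (e.symm ⟨a, h⟩) : α) else a, ?_, ?_⟩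
  · intro a ha b hb hab
    simpa [hIJ ha, hIJ hb, Subtype.val_inj] using hab
  · intro a ha
    by_contra hn
    simp only [hIJ ha, dif_pos] at hn
    have := hσ' (σ.symm (e.symm ⟨a, hIJ ha⟩))
    rw [Equiv.apply_symm_apply, Equiv.apply_symm_apply] at this
    exact this (hw _ _ hn)

end Representation

/-- On a family of vectors in a hyperplane missing the origin, affine and linear independence
agree. -/
theorem affineIndependent_iff_linearIndependent_of_forall_eq_one {ι W : Type*} [AddCommGroup W]
    [Module ℝ W] (φ : W →ₗ[ℝ] ℝ) {p : ι → W} (hp : ∀ i, φ (p i) = 1) :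
    AffineIndependent ℝ p ↔ LinearIndependent ℝ p := by
  rw [affineIndependent_iff, linearIndependent_iff']
  refine ⟨fun h s c hc => h s c ?_ hc, fun h s c _ hc => h s c hc⟩
  simpa [hp] using congrArg φ hc

theorem isTransversal_of_indep_iff_isMatchable {α : Type u} [Finite α] {M : Matroid α}
    (hE : M.E = Set.univ) {V : α → Set α} (hM : ∀ I, M.Indep I ↔ IsMatchable V I) :
    IsTransversal M := by
  classical
  have e := Finite.equivFin α
  refine ⟨Nat.card α, fun j => {y | e.symm j ∈ V y}, fun j => hE ▸ Set.subset_univ _, fun I => ?_⟩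
  rw [hM]
  constructor
  · rintro ⟨f, hf, hfV⟩
    exact ⟨fun x => e (f x), fun x y hxy => Subtype.ext (hf x.2 y.2 (e.injective hxy)),
      fun x => by simpa using hfV x x.2⟩
  · rintro ⟨f, hf, hfV⟩
    refine ⟨fun a => if h : a ∈ I then e.symm (f ⟨a, h⟩) else a, fun a ha b hb hab => ?_,
      fun a ha => ?_⟩
    · simp only [ha, hb, dif_pos] at hab
      exact congrArg Subtype.val (hf (e.symm.injective hab))
    · simpa [ha] using hfV ⟨a, ha⟩

/-- `M` is the transversal matroid with presentation `{a | b ∈ V a}`, `b ∈ B`, in which the only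
neighbour of each `b ∈ B` is `b` itself. -/
structure IsFundamentalPresentation {α : Type*} (M : Matroid α) (B : Set α) (V : α → Set α) :
    Prop where
  ground_eq : M.E = Set.univ
  subset : ∀ a, V a ⊆ B
  vertex : ∀ b ∈ B, V b = {b}
  indep_iff : ∀ I, M.Indep I ↔ IsMatchable V I

/-! ### Closure, circuits and cyclic flats of a fundamental transversal matroid. -/

namespace IsFundamentalPresentation

variable {α : Type u} {M : Matroid α} {B : Set α} {V : α → Set α}
  (h : IsFundamentalPresentation M B V)
include h

theorem mem_ground (a : α) : a ∈ M.E := h.ground_eq ▸ Set.mem_univ a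

theorem subset_ground (S : Set α) : S ⊆ M.E := fun a _ => h.mem_ground a

theorem mem_self {b : α} (hb : b ∈ B) : b ∈ V b := h.vertex b hb ▸ Set.mem_singleton b

theorem eq_of_mem {b c : α} (hb : b ∈ B) (hc : c ∈ V b) : c = b := by
  rwa [h.vertex b hb] at hc

theorem indep_of_subset {I : Set α} (hI : I ⊆ B) : M.Indep I :=
  (h.indep_iff I).2 ⟨id, Function.injective_id.injOn, fun _ ha => h.mem_self (hI ha)⟩

/-- The vertex `b` can only be matched to itself, so `x` can take over its partner. -/
theorem indep_insert_of_mem {I : Set α} {b x : α} (hI : M.Indep (insert b I)) (hbI : b ∉ I)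
    (hbx : b ∈ V x) (hxI : x ∉ I) : M.Indep (insert x I) := by
  classical
  obtain ⟨f, hf, hfV⟩ := (h.indep_iff _).1 hI
  have hfb : f b = b := h.eq_of_mem (h.subset x hbx) (hfV b (Set.mem_insert b I))
  have hne {a} (ha : a ∈ I) : a ≠ x := fun e => hxI (e ▸ ha)
  have hfa {a} (ha : a ∈ I) : f a ≠ b := fun e =>
    hbI (hf (Set.mem_insert_of_mem b ha) (Set.mem_insert b I) (e.trans hfb.symm) ▸ ha)
  refine (h.indep_iff _).2 ⟨Function.update f x b, ?_, ?_⟩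
  · rw [Set.injOn_insert hxI]
    refine ⟨fun a ha c hc hac => ?_, ?_⟩
    · rw [Function.update_of_ne (hne ha), Function.update_of_ne (hne hc)] at hac
      exact hf (Set.mem_insert_of_mem b ha) (Set.mem_insert_of_mem b hc) hac
    · rintro ⟨a, ha, hab⟩
      rw [Function.update_of_ne (hne ha), Function.update_self] at hab
      exact hfa ha hab
  · rintro a (rfl | ha)
    · rwa [Function.update_self]
    · rw [Function.update_of_ne (hne ha)]
      exact hfV a (Set.mem_insert_of_mem b ha)

/-- This is freeness: if a vertex of `V x` extended a basis of `S` independently, then by exchange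
so would `x`. -/
theorem subset_closure_of_mem_closure {x : α} {S : Set α} (hxS : x ∉ S) (hx : x ∈ M.closure S) :
    V x ⊆ M.closure S := by
  intro b hb
  obtain ⟨I, hI⟩ := M.exists_isBasis S (h.subset_ground S)
  rw [← hI.closure_eq_closure] at hx ⊢
  by_contra hbI
  have hbI' : b ∉ I := fun hb => hbI (M.subset_closure I (h.subset_ground I) hb)
  have hxI : x ∉ I := fun hxI => hxS (hI.subset hxI)
  have h1 := (hI.indep.insert_indep_iff_of_notMem hbI').2 ⟨h.mem_ground b, hbI⟩
  exact ((hI.indep.insert_indep_iff_of_notMem hxI).1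
    (h.indep_insert_of_mem h1 hbI' hb hxI)).2 hx

theorem closure_eq {Y : Set α} (hY : Y ⊆ B) : M.closure Y = {x | V x ⊆ Y} := by
  have hYi := h.indep_of_subset hY
  ext x
  constructor
  · intro hx
    by_cases hxY : x ∈ Y
    · rw [Set.mem_ofPred_eq, h.vertex x (hY hxY)]
      exact Set.singleton_subset_iff.2 hxY
    · intro b hb
      have hb' := h.subset_closure_of_mem_closure hxY hx hb
      exact (hYi.mem_closure_iff'.1 hb').2
        (h.indep_of_subset (Set.insert_subset (h.subset x hb) hY))
  · intro hx
    refine hYi.mem_closure_iff'.2 ⟨h.mem_ground x, fun hi => ?_⟩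
    obtain ⟨f, hf, hfV⟩ := (h.indep_iff _).1 hi
    -- The partner of `x` is a vertex in `Y`, already matched to itself; injectivity forces `x` to
    -- be that vertex.
    have hfx : f x ∈ Y := hx (hfV x (Set.mem_insert x Y))
    have hfx' : f (f x) = f x :=
      h.eq_of_mem (hY hfx) (hfV (f x) (Set.mem_insert_of_mem x hfx))
    have := hf (Set.mem_insert_of_mem x hfx) (Set.mem_insert x Y) hfx'
    exact this ▸ hfx

theorem isBase : M.IsBase B :=
  (h.indep_of_subset (Set.Subset.refl B)).isBase_of_ground_subset_closure fun x _ => by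
    rw [h.closure_eq (Set.Subset.refl B)]
    exact h.subset x

/-- By `closure_eq`, `V x` spans `x` and no proper subset of it does. -/
theorem isCircuit {x : α} (hx : x ∉ B) : M.IsCircuit (insert x (V x)) := by
  refine (h.indep_of_subset (h.subset x)).insert_isCircuit_of_forall
    (fun hxV => hx (h.subset x hxV)) ?_ fun b hb hxb => ?_
  · rw [h.closure_eq (h.subset x)]
    exact Set.Subset.refl (V x)
  · rw [h.closure_eq (Set.sdiff_subset.trans (h.subset x))] at hxb
    exact (hxb hb).2 rfl

/-- Vertices of the face are covered by the circuit of `x`, other spanned points by their own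
circuits. -/
theorem isCyclicFlat_closure {x : α} (hx : x ∉ B) : IsCyclicFlat M (M.closure (V x)) := by
  refine ⟨M.isFlat_closure _, isCyclic_iff.2 fun y hy => ?_⟩
  have hsub {z} (hzB : z ∉ B) (hz : V z ⊆ V x) : insert z (V z) ⊆ M.closure (V x) := by
    refine Set.insert_subset ?_ (hz.trans (M.subset_closure _ (h.subset_ground _)))
    rwa [h.closure_eq (h.subset x)]
  rw [h.closure_eq (h.subset x)] at hy
  by_cases hyB : y ∈ B
  · exact ⟨_, h.isCircuit hx, hsub hx subset_rfl, Or.inr (hy (h.mem_self hyB))⟩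
  · exact ⟨_, h.isCircuit hyB, hsub hyB hy, Or.inl rfl⟩

variable {F : Set α}

theorem face_subset_of_mem_isCyclicFlat (hF : IsCyclicFlat M F) {x : α} (hx : x ∈ F) :
    V x ⊆ F := by
  obtain ⟨C, hC, hCF, hxC⟩ := isCyclic_iff.1 hF.2 x hx
  have h1 := h.subset_closure_of_mem_closure (S := C \ {x}) (fun hx => hx.2 rfl)
    (hC.mem_closure_sdiff_singleton_of_mem hxC)
  rw [← hF.1.closure]
  exact h1.trans (M.closure_subset_closure (Set.sdiff_subset.trans hCF))

theorem closure_inter_eq (hF : IsCyclicFlat M F) : M.closure (F ∩ B) = F := by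
  refine Set.Subset.antisymm ?_ fun x hx => ?_
  · rw [← hF.1.closure]
    exact M.closure_subset_closure (hF.1.closure.symm ▸ Set.inter_subset_left)
  · rw [h.closure_eq Set.inter_subset_right]
    exact Set.subset_inter (h.face_subset_of_mem_isCyclicFlat hF hx) (h.subset x)

/-- Otherwise, for a circuit `C` through `b` in `F`, a matching of `C \ {b}` never uses `b` as a
partner, so `b ↦ b` extends it and `C` is independent. -/
theorem exists_mem_face (hF : IsCyclicFlat M F) {b : α} (hbF : b ∈ F) (hbB : b ∈ B) :
    ∃ x ∈ F, x ∉ B ∧ b ∈ V x := by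
  classical
  by_contra! hn
  obtain ⟨C, hC, hCF, hbC⟩ := isCyclic_iff.1 hF.2 b hbF
  obtain ⟨f, hf, hfV⟩ := (h.indep_iff _).1 (hC.sdiff_singleton_indep hbC)
  have hfa {a} (ha : a ∈ C \ {b}) : f a ≠ b := by
    intro e
    have hba := e ▸ hfV a ha
    by_cases haB : a ∈ B
    · exact ha.2 (h.eq_of_mem haB hba).symm
    · exact hn a (hCF ha.1) haB hba
  have hb : b ∉ C \ {b} := fun hb => hb.2 rfl
  refine hC.not_indep ((h.indep_iff C).2 ⟨Function.update f b b, ?_, ?_⟩)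
  · rw [← Set.insert_sdiff_self_of_mem hbC, Set.injOn_insert hb]
    refine ⟨fun a ha c hc hac => ?_, ?_⟩
    · rw [Function.update_of_ne ha.2, Function.update_of_ne hc.2] at hac
      exact hf ha hc hac
    · rintro ⟨a, ha, hab⟩
      rw [Function.update_of_ne ha.2, Function.update_self] at hab
      exact hfa ha hab
  · intro a ha
    by_cases hab : a = b
    · rw [hab, Function.update_self]
      exact h.mem_self hbB
    · rw [Function.update_of_ne hab]
      exact hfV a ⟨ha, hab⟩

theorem isFundamentalBasis : IsFundamentalBasis M B :=
  ⟨h.isBase, fun F hF => ⟨F ∩ B, Set.inter_subset_right, h.closure_inter_eq hF⟩⟩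

/-! ### Duality by reversing the bipartite graph. -/

theorem exists_matching_of_isBase [Finite α] {J : Set α} (hJ : M.IsBase J) :
    ∃ f : α → α, Set.BijOn f J B ∧ ∀ a ∈ J, f a ∈ V a := by
  obtain ⟨f, hf, hfV⟩ := (h.indep_iff J).1 hJ.indep
  have hmap : Set.MapsTo f J B := fun a ha => h.subset a (hfV a ha)
  have hcard : (f '' J).ncard = B.ncard :=
    (Set.InjOn.ncard_image hf).trans (hJ.ncard_eq_ncard_of_isBase h.isBase)
  refine ⟨f, ⟨hmap, hf, ?_⟩, hfV⟩
  exact (Set.eq_of_subset_of_ncard_le hmap.image_subset hcard.ge).ge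

theorem isBase_of_indep_of_ncard_le [Finite α] {J : Set α} (hJ : M.Indep J)
    (hcard : B.ncard ≤ J.ncard) : M.IsBase J := by
  obtain ⟨K, hK, hJK⟩ := hJ.exists_isBase_superset
  have := hK.ncard_eq_ncard_of_isBase h.isBase
  exact Set.eq_of_subset_of_ncard_le hJK (this.trans_le hcard) ▸ hK

/-- The dual of a fundamental transversal matroid is the fundamental transversal matroid of the
reversed bipartite graph. -/
theorem dual_indep_iff [Finite α] (I : Set α) :
    M✶.Indep I ↔ IsMatchable (fun a => {x | x ∉ B ∧ (x = a ∨ a ∈ V x)}) I := by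
  classical
  rw [Matroid.dual_indep_iff_exists (h.subset_ground I)]
  constructor
  · rintro ⟨J, hJ, hIJ⟩
    obtain ⟨f, hf, hfV⟩ := h.exists_matching_of_isBase hJ
    -- As `b ∉ J`, the element of `J` matched to `b` is not `b`, hence not a vertex.
    have key (b) (hb : b ∈ B) (hbI : b ∈ I) : ∃ x ∈ J, f x = b ∧ x ∉ B := by
      obtain ⟨x, hx, rfl⟩ := hf.surjOn hb
      refine ⟨x, hx, rfl, fun hxB => ?_⟩
      have := h.eq_of_mem hxB (hfV x hx)
      rw [this] at hbI
      exact Set.disjoint_left.1 hIJ hbI hx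
    choose! k hkJ hfk hkB using key
    refine ⟨fun a => if a ∈ B then k a else a, fun a ha c hc hac => ?_, fun a ha => ?_⟩
    · by_cases haB : a ∈ B <;> by_cases hcB : c ∈ B <;>
        simp only [haB, hcB, if_true, if_false] at hac
      · rw [← hfk a haB ha, hac, hfk c hcB hc]
      · exact (Set.disjoint_left.1 hIJ hc (hac ▸ hkJ a haB ha)).elim
      · exact (Set.disjoint_left.1 hIJ ha (hac ▸ hkJ c hcB hc)).elim
      · exact hac
    · by_cases haB : a ∈ B <;> simp only [haB, if_true, if_false]
      · refine ⟨hkB a haB ha, Or.inr ?_⟩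
        have := hfV (k a) (hkJ a haB ha)
        rwa [hfk a haB ha] at this
      · exact ⟨haB, Or.inl rfl⟩
  · rintro ⟨k, hk, hkW⟩
    have hkV {b} (hb : b ∈ I ∩ B) : b ∈ V (k b) := by
      obtain ⟨h1, h2 | h2⟩ := hkW b hb.1
      · exact (h1 (by rw [h2]; exact hb.2)).elim
      · exact h2
    -- A non-vertex in `I` has only itself as partner, so `k b ∈ I` would contradict injectivity of
    -- `k`.
    have hkI {b} (hb : b ∈ I ∩ B) : k b ∉ I := by
      intro hkb
      obtain ⟨h1, h2 | h2⟩ := hkW (k b) hkb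
      · have := hk hkb hb.1 h2
        exact (hkW b hb.1).1 (by rw [this]; exact hb.2)
      · exact (hkW b hb.1).1 (h.subset _ h2)
    have hkinj : Set.InjOn k (I ∩ B) := hk.mono Set.inter_subset_left
    have hdisj : Disjoint (B \ I) (k '' (I ∩ B)) := by
      rw [Set.disjoint_left]
      rintro _ hb ⟨b, hbI, rfl⟩
      exact (hkW b hbI.1).1 hb.1
    have key (x) (hx : x ∈ k '' (I ∩ B)) : ∃ b ∈ I ∩ B, k b = x := hx
    choose! g hgI hkg using key
    -- Exchanging the vertices in `I` for their partners turns `B` into a base avoiding `I`.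
    refine ⟨B \ I ∪ k '' (I ∩ B), h.isBase_of_indep_of_ncard_le ?_ ?_, ?_⟩
    · refine (h.indep_iff _).2 ⟨fun a => if a ∈ B then a else g a, ?_, ?_⟩
      · rw [Set.injOn_union hdisj]
        refine ⟨fun a ha c hc hac => ?_, fun a ha c hc hac => ?_, fun a ha c hc hac => ?_⟩
        · simpa [ha.1, hc.1] using hac
        · have haB : a ∉ B := by obtain ⟨b, hb, rfl⟩ := ha; exact (hkW b hb.1).1
          have hcB : c ∉ B := by obtain ⟨b, hb, rfl⟩ := hc; exact (hkW b hb.1).1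
          simp only [haB, hcB, if_false] at hac
          rw [← hkg a ha, hac, hkg c hc]
        · have hcB : c ∉ B := by obtain ⟨b, hb, rfl⟩ := hc; exact (hkW b hb.1).1
          simp only [ha.1, hcB, if_true, if_false] at hac
          exact ha.2 (hac ▸ (hgI c hc).1)
      · rintro a (ha | ha)
        · simpa [ha.1] using h.mem_self ha.1
        · have haB : a ∉ B := by obtain ⟨b, hb, rfl⟩ := ha; exact (hkW b hb.1).1
          simp only [haB, if_false]
          have := hkV (hgI a ha)
          rwa [hkg a ha] at this
    · rw [Set.ncard_union_eq hdisj, Set.InjOn.ncard_image hkinj, Set.inter_comm,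
        add_comm, Set.ncard_inter_add_ncard_sdiff_eq_ncard]
    · rw [Set.disjoint_union_right]
      refine ⟨Set.disjoint_sdiff_right, Set.disjoint_left.2 ?_⟩
      rintro _ ha ⟨b, hb, rfl⟩
      exact hkI hb ha

theorem isBitransversal [Finite α] : IsBitransversal M :=
  ⟨isTransversal_of_indep_iff_isMatchable h.ground_eq h.indep_iff,
    isTransversal_of_indep_iff_isMatchable h.ground_eq h.dual_indep_iff⟩

end IsFundamentalPresentation

/-! ### Existence of free placements. -/

/-- Every system of faces of a simplex has a free placement. -/
theorem exists_isFreeSimplexPlacement {α : Type u} [Finite α] {B : Set α} {V : α → Set α}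
    (hVB : ∀ a, V a ⊆ B) (hB : ∀ b ∈ B, V b = {b}) :
    ∃ M : Matroid α, IsFundamentalPresentation M B V ∧
      ∃ p : α → (B → ℝ), IsFreeSimplexPlacement M B V p := by
  classical
  have := Fintype.ofFinite B
  obtain ⟨w, hnn, hzero, hsum, hdet⟩ :=
    exists_normalized_generic_weight (fun a => {i : B | (i : α) ∈ V a})
  have hsum' (a) (ha : (V a).Nonempty) : ∑ i, w a i = 1 := by
    obtain ⟨b, hb⟩ := ha
    exact hsum a ⟨⟨b, hVB a hb⟩, hb⟩
  have hwB (b : B) : w b = Pi.single b 1 := by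
    have hz (i : B) (hi : i ≠ b) : w b i = 0 := hzero b i (by
      rw [Set.mem_ofPred_eq, hB b b.2]
      exact fun h => hi (Subtype.ext h))
    have h1 := hsum' b ⟨b, hB b b.2 ▸ rfl⟩
    rw [Fintype.sum_eq_single b hz] at h1
    ext i
    by_cases hi : i = b
    · rw [hi, h1, Pi.single_eq_same]
    · rw [hz i hi, Pi.single_eq_of_ne hi]
  have hM : IsFundamentalPresentation (linearMatroid w) B V :=
    ⟨rfl, hVB, hB, fun I => ⟨fun hI => isMatchable_of_linearIndepOn hzero hwB hI,
      fun hI => hI.linearIndepOn hVB hB hdet⟩⟩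
  -- Normalization puts every non-loop in the hyperplane of coordinate sum one, where affine and
  -- linear independence agree.
  let φ : (B → ℝ) →ₗ[ℝ] ℝ := ∑ i, LinearMap.proj i
  have hφ (a) (ha : (V a).Nonempty) : φ (w a) = 1 := by
    rw [← hsum' a ha]
    simp [φ]
  have hVne (b) (hb : b ∈ B) : (V b).Nonempty := ⟨b, hM.mem_self hb⟩
  refine ⟨linearMatroid w, hM, w, hM.subset_ground B, ?_, fun x _ => hVB x, ?_, ?_, ?_⟩
  · rw [affineIndependent_iff_linearIndependent_of_forall_eq_one φ fun b : B => hφ b (hVne b b.2)]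
    exact hM.indep_of_subset subset_rfl
  · intro x hx hne
    -- The weights of `x` are its barycentric coordinates in its face.
    have hx1 : w x = ∑ b ∈ Finset.univ.filter (fun b : B => (b : α) ∈ V x), w x b • w b := by
      rw [Finset.sum_filter_of_ne]
      · conv_lhs => rw [← Finset.univ_sum_single (w x)]
        refine Finset.sum_congr rfl fun b _ => ?_
        rw [hwB, ← Pi.single_smul, smul_eq_mul, mul_one]
      · intro b _ hb
        by_contra hn
        exact hb (by rw [hzero x b hn, zero_smul])
    rw [hx1]
    refine (convex_convexHull ℝ _).sum_mem (fun b _ => hnn x b) ?_ ?_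
    · rw [Finset.sum_filter_of_ne, hsum' x hne]
      intro b _ hb
      by_contra hn
      exact hb (hzero x b hn)
    · intro b hb
      exact subset_convexHull ℝ _ ⟨b, (Finset.mem_filter.1 hb).2, rfl⟩
  · intro I
    constructor
    · intro hI
      have hne (a) (ha : a ∈ I) : (V a).Nonempty := by
        obtain ⟨f, -, hfV⟩ := (hM.indep_iff I).1 hI
        exact ⟨f a, hfV a ha⟩
      refine ⟨hM.subset_ground I, fun x hx => hne x hx.1, ?_⟩
      rw [affineIndependent_iff_linearIndependent_of_forall_eq_one φ fun i : I => hφ i (hne i i.2)]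
      exact hI
    · rintro ⟨-, hne, hI⟩
      have hne' (a) (ha : a ∈ I) : (V a).Nonempty := by
        by_cases haB : a ∈ B
        · exact hVne a haB
        · exact hne a ⟨ha, haB⟩
      rwa [affineIndependent_iff_linearIndependent_of_forall_eq_one φ
        fun i : I => hφ i (hne' i i.2)] at hI
  · intro x _ S hS hxS
    exact hM.subset_closure_of_mem_closure (fun hx => (hS hx).2 rfl) hxS

/-! ### The matroid of a lattice. -/

/-- The neighbourhoods of the fundamental transversal matroid of a lattice `L`: its basis is a copy
of `L`, and the point attached to `a` is placed in the face `{m | ¬ a ≤ m}`. -/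
def latticeFace (L : Type*) [LE L] : L ⊕ L → Set (L ⊕ L)
  | Sum.inl m => {Sum.inl m}
  | Sum.inr a => Sum.inl '' {m | ¬ a ≤ m}

section Lattice

variable {L : Type u} [Lattice L]

theorem latticeFace_subset (x : L ⊕ L) : latticeFace L x ⊆ Set.range Sum.inl := by
  rcases x with m | a
  · rintro _ rfl
    exact ⟨m, rfl⟩
  · exact Set.image_subset_range _ _

theorem inl_mem_latticeFace_inr {a m : L} : Sum.inl m ∈ latticeFace L (Sum.inr a) ↔ ¬ a ≤ m := by
  simp [latticeFace]

/-- The vertex `b` is missing from the face of `b`, but lies in that of `a` unless `a ≤ b`. -/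
theorem latticeFace_inr_subset_iff {a b : L} :
    latticeFace L (Sum.inr a) ⊆ latticeFace L (Sum.inr b) ↔ a ≤ b := by
  constructor
  · intro hab
    by_contra hn
    exact inl_mem_latticeFace_inr.1 (hab (inl_mem_latticeFace_inr.2 hn)) le_rfl
  · rintro hab _ ⟨m, hm, rfl⟩
    exact inl_mem_latticeFace_inr.2 fun hbm => hm (hab.trans hbm)

variable [Finite L] [Nonempty L] {M : Matroid (L ⊕ L)}

/-- The required element is the join of all `a` whose point lies in `F`: its face is the union of
their faces, which is `F ∩ B` for `B` the set of vertices. -/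
theorem exists_closure_latticeFace_eq
    (hM : IsFundamentalPresentation M (Set.range Sum.inl) (latticeFace L)) {F : Set (L ⊕ L)}
    (hF : IsCyclicFlat M F) : ∃ a, M.closure (latticeFace L (Sum.inr a)) = F := by
  classical
  have := Fintype.ofFinite L
  -- The join may be empty; the face of the bottom element is empty.
  let _ : OrderBot L := Fintype.toOrderBot L
  let A : Finset L := Finset.univ.filter fun a => Sum.inr a ∈ F
  refine ⟨A.sup id, ?_⟩
  rw [← hM.closure_inter_eq hF]
  congr 1
  ext x
  constructor
  · rintro ⟨m, hm, rfl⟩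
    rw [Set.mem_ofPred_eq, Finset.sup_le_iff] at hm
    push Not at hm
    obtain ⟨a, ha, ham⟩ := hm
    exact ⟨hM.face_subset_of_mem_isCyclicFlat hF (Finset.mem_filter.1 ha).2
      (inl_mem_latticeFace_inr.2 ham), m, rfl⟩
  · rintro ⟨hmF, m, rfl⟩
    obtain ⟨x, hxF, hxB, hmx⟩ := hM.exists_mem_face hF hmF ⟨m, rfl⟩
    rcases x with n | a
    · exact (hxB ⟨n, rfl⟩).elim
    · have ha : a ∈ A := Finset.mem_filter.2 ⟨Finset.mem_univ a, hxF⟩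
      exact inl_mem_latticeFace_inr.2 fun h =>
        inl_mem_latticeFace_inr.1 hmx ((Finset.le_sup (f := id) ha).trans h)

theorem nonempty_orderIso_cyclicFlat
    (hM : IsFundamentalPresentation M (Set.range Sum.inl) (latticeFace L)) :
    Nonempty (L ≃o CyclicFlat M) := by
  let φ : L → CyclicFlat M := fun a =>
    ⟨M.closure (latticeFace L (Sum.inr a)), hM.isCyclicFlat_closure (by simp)⟩
  have hφ (a b : L) : φ a ≤ φ b ↔ a ≤ b := by
    rw [← latticeFace_inr_subset_iff (a := a)]
    constructor
    · intro hab
      have h0 : Sum.inr a ∈ M.closure (latticeFace L (Sum.inr a)) := by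
        rw [hM.closure_eq (latticeFace_subset _)]
        exact Set.Subset.refl (latticeFace L (Sum.inr a))
      have h1 : Sum.inr a ∈ M.closure (latticeFace L (Sum.inr b)) := hab h0
      rwa [hM.closure_eq (latticeFace_subset _)] at h1
    · exact fun hab => M.closure_subset_closure hab
  refine ⟨RelIso.ofSurjective (OrderEmbedding.ofMapLEIff φ hφ) fun F => ?_⟩
  obtain ⟨a, ha⟩ := exists_closure_latticeFace_eq hM F.2
  exact ⟨a, Subtype.ext ha⟩

end Lattice

end CyclicFlatLattice

theorem theorem2p1 (L : Type u) [Lattice L] [Finite L] [Nonempty L] :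
    ∃ (α : Type u) (M : Matroid α),
      M.Finite ∧
      CyclicFlatLattice.IsBitransversal M ∧
      (∃ B : Set α, CyclicFlatLattice.IsFundamentalBasis M B ∧
        ∃ (V : α → Set α) (p : α → (B → ℝ)),
          CyclicFlatLattice.IsFreeSimplexPlacement M B V p) ∧
      Nonempty (L ≃o CyclicFlatLattice.CyclicFlat M) := by
  obtain ⟨M, hM, p, hp⟩ := CyclicFlatLattice.exists_isFreeSimplexPlacement
    (B := Set.range Sum.inl) (V := CyclicFlatLattice.latticeFace L)
    CyclicFlatLattice.latticeFace_subset (by rintro _ ⟨m, rfl⟩; rfl)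
  exact ⟨L ⊕ L, M, ⟨Set.toFinite _⟩, hM.isBitransversal,
    ⟨_, hM.isFundamentalBasis, _, p, hp⟩, CyclicFlatLattice.nonempty_orderIso_cyclicFlat hM⟩
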